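/- Conventions. Let $1\le a\le b\le\tau$ be integers and let $A$ be a finite field (the alphabet). An erasure pattern $E\subseteq\mathbb{N}=\{0,1,2,\dots\}$ is admissible for $(a,b,\tau)$ if for every window $[s:s+\tau]$ either $|E\cap[s:s+\tau]|\le a$ or $E\cap[s:s+\tau]$ is contained in an interval of $b$ consecutive times. A packet-level code with message packets $u(t)\in A^k$ and coded packets $x(t)\in A^n$, $t\in\mathbb{N}$, is the set of outputs of a systematic causal encoder: the first $k$ components of $x(t)$ are $u(t)$, and $x(t)$ is a function of $\{u(s): s\le t\}$. Its rate is $k/n$. It is an $(a,b,\tau)$ streaming code if for every admissible $E$ and every $t$ the message packet $u(t)$ is determined by $\{x(s): s\le t+\tau,\ s\notin E\}$. Let $\mathbb{C}$ be an $[n,k]$ linear code over $\mathbb{F}_q$ whose first $k$ symbols form an information set, and let $S=\{0=s_0<s_1<\dots<s_{n-1}=N-1\}$ be a set of integers (a placement set of dispersion span $N$). Then $\mathrm{SDE}(\mathbb{C},S)$ (staggered diagonal embedding) is the packet-level code consisting of all packet streams $(x(t))_{t\ge 0}$, extended by $x(t)=0$ for $t<0$, with $(x_0(t+s_0),\dots,x_{n-1}(t+s_{n-1}))\in\mathbb{C}$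 for all $t\in\mathbb{Z}$. A $k\times n$ matrix $Z$ is a zero-band MDS generator matrix if it is a generator matrix of an $[n,k]$ MDS code and $z_{ij}=0$ whenever $j\in[i+1:i+k-1]\pmod n$ (rows and columns are indexed from $0$). A Cauchy matrix is a matrix with entries $c_{ij}=1/(\xi_i-\eta_j)$, where all the $\xi_i,\eta_j$ are distinct. For $r=\ell a$ with $\ell\ge1$, and $\rho>r$, let $Z=[Z_1\ Z_2]$ be an $a\times 2a$ zero-band MDS generator matrix ($Z_1,Z_2$ of size $a\times a$) and $C$ an $r\times(\rho-r)$ Cauchy matrix. The base code $\mathbb{C}_{a,r,\rho}$ is the code of length $n=\rho-a+r$ with the $r\times n$ parity-check matrix $H$ that has $I_a$ in rows and columns $[0:a-1]$; $Z_1$ in rows and columns $[ia:ia+a-1]$ for $1\le i\le\ell-1$; $C$ in columns $[r:\rho-1]$; $Z_2$ in rows $[ia:ia+a-1]$ and columns $[\rho+(i-1)a:\rho+ia-1]$ for $1\le i\le\ell-1$; and zeros elsewhere. Theorem. Let $1\le a\le b\le\tau$ and $g\ge0$ be integers with $\gcd(b,\tau+1-a)=a+g$, and set $\ell=b/(a+g)$,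 $m=(\tau+1-a)/(a+g)$ and $$S_{a,b,\tau}=\bigcup_{i=0}^{m+\ell-1}[i(a+g):i(a+g)+a-1].$$ Then: 1. $S_{a,b,\tau}$ is a placement set with $n=(m+\ell)a$ elements and dispersion span $N=(m+\ell-1)(a+g)+a$. 2. For every finite field $\mathbb{F}_q$, every $a\times 2a$ zero-band MDS generator matrix $Z$ and every $\ell a\times(m+1-\ell)a$ Cauchy matrix $C$ over $\mathbb{F}_q$, the base code $\mathbb{C}_{a,\ell a,(m+1)a}$ is an $[n=(m+\ell)a,\ k=ma]$ code whose first $k$ symbols form an information set, and $\mathrm{SDE}(\mathbb{C}_{a,\ell a,(m+1)a},S_{a,b,\tau})$ is an $(a,b,\tau)$ streaming code with message packets of length $k=ma$. 3. Its rate is $\frac{m}{m+\ell}=\frac{\tau+1-a}{\tau+1-a+b}$, and no $(a,b,\tau)$ streaming code over any finite field has a larger rate. 4. It needs a field of size only $O(\tau)$: such $Z$ and $C$ exist over every finite field with $q\ge(m+1)a$ elements, $(m+1)a\le\tau+1$, and there is a prime power $q$ with $(m+1)a\le q\le 2(\tau+1)$. -/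

import Mathlib

namespace StreamingCodes

/-! ### Packet-level codes and the sliding-window erasure channel -/

/-- The erasure patterns of the delay-constrained sliding-window channel with window length
`τ + 1`: within every window `[s, s + τ]`, either at most `a` packets are erased, or all the
erasures of the window lie in a burst (an interval of consecutive times) of length `b`. -/
def IsAdmissible (a b τ : ℕ) (E : Set ℕ) : Prop :=
  ∀ s : ℕ, (E ∩ Set.Icc s (s + τ)).ncard ≤ a ∨
    ∃ c : ℕ, E ∩ Set.Icc s (s + τ) ⊆ Set.Ico c (c + b)

/-- An encoder, mapping a stream of message packets `u t ∈ A ^ k` to a stream of coded packets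
`x t ∈ A ^ n` (`t = 0, 1, 2, …`), which is systematic (the first `k` components of the coded packet
at time `t` are the message packet at time `t`) and causal (the coded packet at time `t` depends
only on the message packets up to time `t`). -/
structure IsEncoder {A : Type*} {k n : ℕ} (enc : (ℕ → Fin k → A) → ℕ → Fin n → A) : Prop where
  le : k ≤ n
  systematic : ∀ (u : ℕ → Fin k → A) (t : ℕ) (i : Fin k), enc u t (Fin.castLE le i) = u t i
  causal : ∀ (u u' : ℕ → Fin k → A) (t : ℕ), (∀ s ≤ t, u s = u' s) → enc u t = enc u' t

/-- `X`, a set of streams of coded packets of length `n`, is an `(a, b, τ)` streaming code with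
message packets of length `k`: `X` is the set of outputs of a systematic causal encoder such that,
for every admissible erasure pattern `E` and every time `t`, the message packet at time `t` is
determined by the packets which are not erased and arrive no later than time `t + τ`. -/
def IsStreamingCode {A : Type*} {n : ℕ} (a b τ k : ℕ) (X : Set (ℕ → Fin n → A)) : Prop :=
  ∃ enc : (ℕ → Fin k → A) → ℕ → Fin n → A, IsEncoder enc ∧ Set.range enc = X ∧
    ∀ E : Set ℕ, IsAdmissible a b τ E → ∀ (t : ℕ) (u u' : ℕ → Fin k → A),
      (∀ s ≤ t + τ, s ∉ E → enc u s = enc u' s) → u t = u' t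

/-- The value `(τ + 1 - a) / (τ + 1 - a + b)`. -/
def optimalRate (a b τ : ℕ) : ℚ := ((τ : ℚ) + 1 - a) / ((τ : ℚ) + 1 - a + b)

/-! ### Staggered diagonal embedding -/

/-- `C` is an `[n, k]` code whose first `k` symbols form an information set. -/
def IsInfoPrefix {F : Type*} [Field F] {n : ℕ} (C : Submodule F (Fin n → F)) (k : ℕ) : Prop :=
  ∃ h : k ≤ n, Function.Bijective fun (c : C) (i : Fin k) => (c : Fin n → F) (Fin.castLE h i)

/-- `S = {s₀ < s₁ < ⋯ < s_{n-1}}` is a placement set with `n` elements and dispersion span `N`: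
`s₀ = 0` and `s_{n-1} = N - 1`. -/
structure IsPlacementSet (n N : ℕ) (S : Finset ℕ) : Prop where
  card_eq : S.card = n
  subset_range : S ⊆ Finset.range N
  zero_mem : 0 ∈ S
  last_mem : N - 1 ∈ S

/-- The element `sᵢ` of `S = {s₀ < s₁ < ⋯}`. -/
noncomputable def place (S : Finset ℕ) (i : ℕ) : ℕ := Nat.nth (fun j => j ∈ S) i

/-- A packet stream, extended by zero packets to negative times. -/
def extendZero {F : Type*} [Zero F] {n : ℕ} (x : ℕ → Fin n → F) (t : ℤ) : Fin n → F :=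
  if 0 ≤ t then x t.toNat else 0

/-- The packet-level code obtained from the base code `C` by staggered diagonal embedding with the
placement set `S`: the packet streams `x`, starting at time `0`, with
`(x₀(t + s₀), x₁(t + s₁), …, x_{n-1}(t + s_{n-1})) ∈ C` for all `t`. -/
def SDE {F : Type*} [Field F] {n : ℕ} (C : Submodule F (Fin n → F)) (S : Finset ℕ) :
    Set (ℕ → Fin n → F) :=
  {x | ∀ t : ℤ, (fun i : Fin n => extendZero x (t + (place S i : ℤ)) i) ∈ C}

/-! ### Building blocks -/

open Classical in
/-- `Z` is a generator matrix of an `[n, k]` MDS code: its rows are linearly independent, and every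
nonzero vector of the row space has Hamming weight at least `n - k + 1`. -/
def IsMDSGenerator {F : Type*} [Field F] {k n : ℕ} (Z : Matrix (Fin k) (Fin n) F) : Prop :=
  LinearIndependent F Z.row ∧
    ∀ v ∈ Submodule.span F (Set.range Z.row), v ≠ 0 → n + 1 ≤ hammingNorm v + k

/-- `Z` is a zero-band MDS generator matrix: a generator matrix of an `[n, k]` MDS code with
`Z i j = 0` whenever `j ∈ [i + 1 : i + k - 1] (mod n)`. -/
def IsZeroBandMDS {F : Type*} [Field F] {k n : ℕ} (Z : Matrix (Fin k) (Fin n) F) : Prop :=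
  IsMDSGenerator Z ∧
    ∀ (i : Fin k) (j : Fin n),
      (∃ d ∈ Finset.Icc 1 (k - 1), (j : ℕ) = ((i : ℕ) + d) % n) → Z i j = 0

/-- `C` is a Cauchy matrix: `C i j = 1 / (xᵢ - yⱼ)` where the `xᵢ` and the `yⱼ` are all distinct. -/
def IsCauchy {F : Type*} [Field F] {r c : ℕ} (C : Matrix (Fin r) (Fin c) F) : Prop :=
  ∃ (x : Fin r → F) (y : Fin c → F), Function.Injective x ∧ Function.Injective y ∧
    (∀ i j, x i ≠ y j) ∧ ∀ i j, C i j = 1 / (x i - y j)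

theorem pos_of_row {a ℓ : ℕ} (p : Fin (ℓ * a)) : 0 < a :=
  Nat.pos_of_ne_zero fun h => absurd p.2 (by simp [h])

/-- The `r × (ρ - a + r)` parity-check matrix of the base code with parameters `a`, `r = ℓ a`, `ρ`.
In blocks of `a` rows and columns, with `Z = [Z₁ Z₂]`: `I_a` at block position `(0, 0)`; `Z₁` at
the block positions `(i, i)`, `1 ≤ i ≤ ℓ - 1`; the matrix `C` in all rows and the columns
`r, …, ρ - 1`; `Z₂` in block row `i` and the columns `ρ + (i - 1) a, …, ρ + i a - 1`,
`1 ≤ i ≤ ℓ - 1`; zeros elsewhere. -/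
def parityCheck {F : Type*} [Field F] (a ℓ ρ : ℕ) (Z : Matrix (Fin a) (Fin (2 * a)) F)
    (C : Matrix (Fin (ℓ * a)) (Fin (ρ - ℓ * a)) F) :
    Matrix (Fin (ℓ * a)) (Fin (ρ - a + ℓ * a)) F := fun p q =>
  have ha : 0 < a := pos_of_row p
  let row : Fin a := ⟨p % a, Nat.mod_lt _ ha⟩
  if (q : ℕ) < a then
    if (p : ℕ) = q then 1 else 0
  else if (q : ℕ) < ℓ * a then
    if (p : ℕ) / a = q / a then
      Z row ⟨q % a, by have := Nat.mod_lt (q : ℕ) ha; omega⟩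
    else 0
  else if h : ℓ * a ≤ (q : ℕ) ∧ (q : ℕ) < ρ then
    C p ⟨q - ℓ * a, by omega⟩
  else
    if (p : ℕ) / a = (q - ρ) / a + 1 then
      Z row ⟨a + (q - ρ) % a, by have := Nat.mod_lt ((q : ℕ) - ρ) ha; omega⟩
    else 0

/-- The base code: the code of length `ρ - a + ℓ a` with the above parity-check matrix. -/
def baseCode {F : Type*} [Field F] (a ℓ ρ : ℕ) (Z : Matrix (Fin a) (Fin (2 * a)) F)
    (C : Matrix (Fin (ℓ * a)) (Fin (ρ - ℓ * a)) F) : Submodule F (Fin (ρ - a + ℓ * a) → F) :=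
  LinearMap.ker (parityCheck a ℓ ρ Z C).mulVecLin

/-- With `d = gcd(b, τ + 1 - a)`, `ℓ = b / d` and `m = (τ + 1 - a) / d`, the block placement set
`⋃ [i d : i d + a - 1]`, the union over `0 ≤ i ≤ m + ℓ - 1`. -/
def placementSet (a b τ : ℕ) : Finset ℕ :=
  (Finset.range ((τ + 1 - a) / Nat.gcd b (τ + 1 - a) + b / Nat.gcd b (τ + 1 - a))).biUnion
    fun i => Finset.Ico (i * Nat.gcd b (τ + 1 - a)) (i * Nat.gcd b (τ + 1 - a) + a)

end StreamingCodes

namespace StreamingCodes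

open Finset

section Matrices

open Polynomial

/-! ### Cauchy matrices -/

/-! Put `d = a + g`, so `b = ℓ d` and `τ + 1 = m d + a`. A diagonal codeword occupies blocks of `a`
consecutive times starting `d` apart. Hence a burst of length `b` hits at most `ℓ a` consecutive
symbols of it, and by the deadline of a symbol in block `i` all blocks up to `m + i` have arrived.
By linearity and induction on time, decoding reduces to the base code: if the symbols before `J`
vanish and the nonzero symbols arriving by the deadline are all erased, then symbol `J` is zero.

Burst: the zero bands make `Z₁` lower and `Z₂` upper triangular. Check `p = i a + e` therefore
involves only the symbols up to `e` of block `i`, those from `e` on of block `m + i` (none if `i =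
0`), and the Cauchy symbols. The checks below `J` whose later symbols all lie past the burst are
pure Cauchy equations, and there are enough of them to annihilate the Cauchy symbols
(`burst_cauchy`). Check `J` then isolates symbol `J` (`burst_first`).

At most `a` erasures: the first `a` checks involve only block `0` and the Cauchy symbols, and force
the latter to vanish. Blocks `i` and `m + i` then form a vector in the kernel of `Z` of weight at
most `a`, hence zero (`sparse_first`).

Converse: under periodic bursts of `b` erasures with gaps of `τ + 1 - a`, the unerased packets must
carry the whole message; counting streams over many periods gives the rate bound
(`IsStreamingCode.mul_le_mul`). -/

theorem IsCauchy.eq_zero_of_vanish {F : Type*} [Field F] {r c : ℕ} {C : Matrix (Fin r) (Fin c) F}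
    (hC : IsCauchy C) (R : Finset (Fin r)) (T : Finset (Fin c)) (hRT : #T ≤ #R) (v : Fin c → F)
    (hv : ∀ i ∈ R, ∑ j ∈ T, C i j * v j = 0) : ∀ j ∈ T, v j = 0 := by
  classical
  obtain ⟨x, y, hx, hy, hxy, hCe⟩ := hC
  intro j hj
  -- The numerator of `∑ v j / (X - y j)`: of degree below `#T`, with a zero at `x i` for each `i ∈
  -- R`, and equal to `v j` times a nonzero factor at `y j`.
  set P : F[X] := ∑ j ∈ T, Polynomial.C (v j) * ∏ l ∈ T.erase j, (X - Polynomial.C (y l)) with hP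
  have hdeg : P.degree < #T := by
    refine (Polynomial.degree_sum_le _ _).trans_lt ?_
    rw [Finset.sup_lt_iff (WithBot.bot_lt_coe _)]
    intro l hl
    refine (degree_mul_le _ _).trans_lt ?_
    refine (add_le_add_left degree_C_le _).trans_lt ?_
    rw [degree_prod, zero_add]
    simp only [degree_X_sub_C, sum_const, card_erase_of_mem hl, nsmul_eq_mul, mul_one]
    have := card_pos.mpr ⟨l, hl⟩
    exact_mod_cast Nat.sub_lt this one_pos
  have hP0 : P = 0 := by
    refine eq_zero_of_degree_lt_of_eval_finset_eq_zero (R.map ⟨x, hx⟩) ?_ ?_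
    · rw [card_map]
      exact hdeg.trans_le (by exact_mod_cast hRT)
    · intro z hz
      obtain ⟨i, hi, rfl⟩ := mem_map.mp hz
      have h1 : P.eval (x i) = (∏ l ∈ T, (x i - y l)) * ∑ j ∈ T, C i j * v j := by
        rw [hP, eval_finsetSum, mul_sum]
        refine sum_congr rfl fun l hl => ?_
        rw [← mul_prod_erase T _ hl, hCe]
        have : x i - y l ≠ 0 := sub_ne_zero.mpr (hxy i l)
        simp only [eval_mul, eval_C, eval_prod, eval_sub, eval_X]
        field_simp
      change P.eval (x i) = 0
      rw [h1, hv i hi, mul_zero]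
  have h2 : P.eval (y j) = v j * ∏ l ∈ T.erase j, (y j - y l) := by
    rw [hP, eval_finsetSum, sum_eq_single_of_mem j hj]
    · simp [eval_prod]
    · intro l _ hlj
      rw [eval_mul, eval_prod]
      rw [prod_eq_zero (i := j) (mem_erase.mpr ⟨hlj.symm, hj⟩) (by simp), mul_zero]
  rw [hP0, eval_zero] at h2
  refine (mul_eq_zero.mp h2.symm).resolve_right (prod_ne_zero_iff.mpr fun l hl => ?_)
  exact sub_ne_zero.mpr fun h => (mem_erase.mp hl).1 (hy h).symm

/-! ### Zero-band MDS generator matrices -/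

theorem hammingNorm_add_card_filter {F : Type*} [Zero F] [DecidableEq F] {n : ℕ} (v : Fin n → F) :
    hammingNorm v + #{j | v j = 0} = n := by
  have := card_filter_add_card_filter_not (s := (univ : Finset (Fin n))) (fun j => v j = 0)
  rw [card_univ, Fintype.card_fin, add_comm] at this
  exact this

theorem hammingNorm_add_card_le {F : Type*} [Zero F] [DecidableEq F] {n : ℕ} (v : Fin n → F)
    (W : Finset (Fin n)) (hW : ∀ j ∈ W, v j = 0) : hammingNorm v + #W ≤ n := by
  refine le_of_le_of_eq (Nat.add_le_add_left (card_le_card ?_) _) (hammingNorm_add_card_filter v)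
  intro j hj
  simpa using hW j hj

/-- A combination of the rows of an MDS generator matrix which vanishes at as many positions as
there are rows is the trivial one. -/
theorem IsMDSGenerator.vecMul_injOn {F : Type*} [Field F] {k n : ℕ} {Z : Matrix (Fin k) (Fin n) F}
    (hZ : IsMDSGenerator Z) (W : Finset (Fin n)) (hW : k ≤ #W) (v : Fin k → F)
    (hv : ∀ j ∈ W, Matrix.vecMul v Z j = 0) : v = 0 := by
  classical
  have hmem : Matrix.vecMul v Z ∈ Submodule.span F (Set.range Z.row) := by
    rw [Matrix.vecMul_eq_sum]
    exact Submodule.sum_mem _ fun i _ => Submodule.smul_mem _ _ (Submodule.subset_span ⟨i, rfl⟩)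
  have h0 : Matrix.vecMul v Z = 0 := by
    by_contra h
    have h1 := hZ.2 _ hmem h
    have h2 := (hammingNorm_add_card_le _ W hv).trans_lt (Nat.lt_of_succ_le h1)
    omega
  have hli := Fintype.linearIndependent_iff.mp hZ.1 v
  rw [Matrix.vecMul_eq_sum] at h0
  exact funext (hli h0)

/-- Any `k` columns of a `k × n` MDS generator matrix are linearly independent. -/
theorem IsMDSGenerator.eq_zero_of_mulVec {F : Type*} [Field F] {k n : ℕ} (hkn : k ≤ n)
    {Z : Matrix (Fin k) (Fin n) F}
    (hZ : IsMDSGenerator Z) (T : Finset (Fin n)) (hT : #T ≤ k) (v : Fin n → F)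
    (hvT : ∀ j ∉ T, v j = 0) (hv : ∀ i, ∑ j, Z i j * v j = 0) : v = 0 := by
  classical
  obtain ⟨W, hTW, -, hW⟩ := exists_subsuperset_card_eq (subset_univ T) hT (by simpa using hkn)
  let φ : (Fin k → F) →ₗ[F] (W → F) :=
    (LinearMap.funLeft F F (fun j : W => (j : Fin n))) ∘ₗ Z.vecMulLinear
  have hφ : ∀ u (j : W), φ u j = Matrix.vecMul u Z j := fun u j => rfl
  have hinj : Function.Injective φ := by
    rw [← LinearMap.ker_eq_bot, LinearMap.ker_eq_bot']
    intro u hu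
    exact hZ.vecMul_injOn W hW.ge u fun j hj => (hφ u ⟨j, hj⟩).symm.trans (congrFun hu _)
  have hsurj : Function.Surjective φ :=
    (LinearMap.injective_iff_surjective_of_finrank_eq_finrank (by simp [hW])).mp hinj
  funext j
  by_cases hj : j ∈ T
  -- The columns in `W` form an invertible square matrix, so some row combination restricts to the
  -- indicator of `j` there; pairing it with `v` gives both `v j` and `0`.
  · obtain ⟨u, hu⟩ := hsurj (Pi.single ⟨j, hTW hj⟩ 1)
    have h1 : ∑ l, Matrix.vecMul u Z l * v l = 0 := by
      simp only [Matrix.vecMul, dotProduct, sum_mul]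
      rw [sum_comm]
      refine sum_eq_zero fun i _ => ?_
      simp only [mul_assoc]
      rw [← mul_sum, hv, mul_zero]
    rw [sum_eq_single j] at h1
    · rw [← hφ u ⟨j, hTW hj⟩, hu] at h1
      simpa using h1
    · intro l _ hlj
      by_cases hl : l ∈ T
      · rw [← hφ u ⟨l, hTW hl⟩, hu, Pi.single_eq_of_ne (by simpa using hlj), zero_mul]
      · rw [hvT l hl, mul_zero]
    · simp
  · exact hvT j hj

/-- With `2 a` columns the band never wraps around, so `Z₁` is lower and `Z₂` upper triangular. -/
theorem IsZeroBandMDS.apply_eq_zero_left {F : Type*} [Field F] {a : ℕ}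
    {Z : Matrix (Fin a) (Fin (2 * a)) F} (hZ : IsZeroBandMDS Z) (i : Fin a) (j : Fin (2 * a))
    (h : (i : ℕ) < j) (hj : (j : ℕ) < i + a) : Z i j = 0 := by
  have hi := i.2
  refine hZ.2 i j ⟨j - i, mem_Icc.mpr ⟨by omega, by omega⟩, ?_⟩
  rw [Nat.mod_eq_of_lt (by omega)]
  omega

/-- Otherwise row `i` would vanish at the `a` consecutive positions from `i` on, too many for a
nonzero codeword. -/
theorem IsZeroBandMDS.diag_ne_zero {F : Type*} [Field F] {a : ℕ}
    {Z : Matrix (Fin a) (Fin (2 * a)) F} (hZ : IsZeroBandMDS Z) (i : Fin a) (j : Fin (2 * a))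
    (h : (i : ℕ) = j) : Z i j ≠ 0 := by
  classical
  intro h0
  have hi := i.2
  have hW := hZ.1.vecMul_injOn ((univ : Finset (Fin a)).image fun e : Fin a =>
      (⟨i + e, by omega⟩ : Fin (2 * a)))
    (by
      rw [card_image_of_injective, card_univ, Fintype.card_fin]
      intro e e' hee
      exact Fin.ext (Nat.add_left_cancel (Fin.mk.inj_iff.mp hee))) (Pi.single i 1) (by
      intro l hl
      obtain ⟨e, -, rfl⟩ := mem_image.mp hl
      rw [Matrix.single_one_vecMul]
      change Z i _ = 0
      rcases Nat.eq_zero_or_pos (e : ℕ) with h1 | h1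
      · convert h0 using 2
        exact Fin.ext (by simp [h1, h])
      · exact hZ.apply_eq_zero_left _ _ (by simp only; omega) (by simp only; omega))
  simpa using congrFun hW i

/-- Reed–Solomon codewords vanishing on the zero bands generate an MDS code. -/
theorem exists_isZeroBandMDS {F : Type*} [Field F] [Finite F] {a : ℕ} (h : 2 * a ≤ Nat.card F) :
    ∃ Z : Matrix (Fin a) (Fin (2 * a)) F, IsZeroBandMDS Z := by
  classical
  have := Fintype.ofFinite F
  obtain ⟨α⟩ : Nonempty (Fin (2 * a) ↪ F) := by
    apply Function.Embedding.nonempty_of_card_le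
    simpa using h
  let band (i : Fin a) : Finset (Fin (2 * a)) := {j | (i : ℕ) < j ∧ (j : ℕ) < i + a}
  have hband : ∀ i, #(band i) < a := by
    intro i
    have hi := i.2
    have : (band i).map Fin.valEmbedding ⊆ Ioo (i : ℕ) (i + a) := by
      intro j hj
      obtain ⟨l, hl, rfl⟩ := mem_map.mp hj
      rw [mem_Ioo]
      exact (mem_filter.mp hl).2
    have := card_le_card this
    rw [card_map, Nat.card_Ioo] at this
    omega
  let f (i : Fin a) : F[X] := ∏ j ∈ band i, (X - C (α j))
  have hf : ∀ i, f i ∈ degreeLT F a := by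
    intro i
    rw [mem_degreeLT]
    simp only [f, degree_prod, degree_X_sub_C, sum_const, nsmul_eq_mul, mul_one]
    exact_mod_cast hband i
  have hval : ∀ i j, (f i).eval (α j) = 0 ↔ j ∈ band i := by
    intro i j
    simp only [f, eval_prod, prod_eq_zero_iff, eval_sub, eval_X, eval_C, sub_eq_zero,
      α.injective.eq_iff]
    simp
  let Z : Matrix (Fin a) (Fin (2 * a)) F := fun i j => (f i).eval (α j)
  have hspan : ∀ v ∈ Submodule.span F (Set.range Z.row),
      ∃ p ∈ degreeLT F a, v = fun j => p.eval (α j) := by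
    intro v hv
    induction hv using Submodule.span_induction with
    | mem x hx => obtain ⟨i, rfl⟩ := hx; exact ⟨f i, hf i, rfl⟩
    | zero => exact ⟨0, Submodule.zero_mem _, by ext; simp⟩
    | add x y _ _ hx hy =>
      obtain ⟨p, hp, rfl⟩ := hx
      obtain ⟨r, hr, rfl⟩ := hy
      exact ⟨p + r, Submodule.add_mem _ hp hr, by ext; simp⟩
    | smul c x _ hx =>
      obtain ⟨p, hp, rfl⟩ := hx
      exact ⟨c • p, Submodule.smul_mem _ _ hp, by ext; simp⟩
  refine ⟨Z, ⟨?_, ?_⟩, ?_⟩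
  · rw [Fintype.linearIndependent_iff]
    intro c hc
    by_contra hne
    push Not at hne
    -- Evaluate at point `i` for the largest `i` in the support: it lies in the band of every
    -- smaller row but not in its own, so only `c i` survives.
    obtain ⟨i, hi, hmax⟩ := exists_max_image (Finset.univ.filter fun i => c i ≠ 0)
      (fun i => (i : ℕ)) ⟨_, mem_filter.mpr ⟨mem_univ _, hne.choose_spec⟩⟩
    have hi' : c i ≠ 0 := (mem_filter.mp hi).2
    have hia := i.2
    have h1 := congrFun hc ⟨i, by omega⟩
    rw [Finset.sum_apply, sum_eq_single i] at h1
    · refine hi' ((mul_eq_zero.mp h1).resolve_right ?_)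
      change (f i).eval _ ≠ 0
      rw [Ne, hval]
      simp [band]
    · intro l _ hl
      by_cases hcl : c l = 0
      · simp [hcl]
      · have := hmax l (mem_filter.mpr ⟨mem_univ _, hcl⟩)
        have hne : (l : ℕ) ≠ i := fun h => hl (Fin.ext h)
        have : (f l).eval (α ⟨i, by omega⟩) = 0 := by
          rw [hval]
          simp only [band, mem_filter, mem_univ, true_and]
          have := l.2
          omega
        simp only [Pi.smul_apply, smul_eq_mul]
        exact mul_eq_zero_of_right _ this
    · simp
  · intro v hv hv0
    obtain ⟨p, hp, rfl⟩ := hspan v hv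
    by_contra hlt
    refine hv0 ?_
    have hp0 : p = 0 := by
      refine eq_zero_of_degree_lt_of_eval_finset_eq_zero
        ((Finset.univ.filter fun j => p.eval (α j) = 0).map α) ?_ ?_
      · rw [mem_degreeLT] at hp
        refine hp.trans_le ?_
        rw [card_map]
        have h1 := (Nat.lt_of_not_le hlt).trans_eq
          (congrArg (· + 1) (hammingNorm_add_card_filter fun j => p.eval (α j)).symm)
        have : a ≤ #(Finset.univ.filter fun j => p.eval (α j) = 0) := by omega
        exact_mod_cast this
      · intro z hz
        obtain ⟨j, hj, rfl⟩ := mem_map.mp hz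
        exact (mem_filter.mp hj).2
    ext j
    simp [hp0]
  · rintro i j ⟨d, hd, hj⟩
    have hi := i.2
    rw [mem_Icc] at hd
    rw [Nat.mod_eq_of_lt (by omega)] at hj
    change (f i).eval (α j) = 0
    rw [hval]
    simp only [band, mem_filter, mem_univ, true_and]
    omega

theorem exists_isCauchy {F : Type*} [Field F] [Finite F] {r c : ℕ} (h : r + c ≤ Nat.card F) :
    ∃ C : Matrix (Fin r) (Fin c) F, IsCauchy C := by
  have := Fintype.ofFinite F
  obtain ⟨α⟩ : Nonempty (Fin r ⊕ Fin c ↪ F) := by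
    apply Function.Embedding.nonempty_of_card_le
    simpa using h
  exact ⟨fun i j => 1 / (α (.inl i) - α (.inr j)), fun i => α (.inl i), fun j => α (.inr j),
    α.injective.comp Sum.inl_injective, α.injective.comp Sum.inr_injective,
    fun i j => α.injective.ne Sum.inl_ne_inr, fun _ _ => rfl⟩

end Matrices

/-! ### The parity checks of the base code -/

/-- The `q`-th symbol of a word, which is zero beyond the length of the word. -/
def symbol {F : Type*} [Zero F] {n : ℕ} (c : Fin n → F) (q : ℕ) : F :=
  if h : q < n then c ⟨q, h⟩ else 0

theorem symbol_of_lt {F : Type*} [Zero F] {n : ℕ} (c : Fin n → F) {q : ℕ} (h : q < n) :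
    symbol c q = c ⟨q, h⟩ := dif_pos h

theorem symbol_of_le {F : Type*} [Zero F] {n : ℕ} (c : Fin n → F) {q : ℕ} (h : n ≤ q) :
    symbol c q = 0 := dif_neg h.not_gt

theorem block_lt {a ℓ i e : ℕ} (hi : i < ℓ) (he : e < a) : i * a + e < ℓ * a := by
  have : (i + 1) * a ≤ ℓ * a := Nat.mul_le_mul_right a hi
  rw [Nat.succ_mul] at this
  omega

theorem block_div {a i e : ℕ} (he : e < a) : (i * a + e) / a = i := by
  rw [mul_comm, Nat.mul_add_div (by omega), Nat.div_eq_of_lt he, add_zero]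

theorem block_mod {a i e : ℕ} (he : e < a) : (i * a + e) % a = e := by
  rw [mul_comm, Nat.mul_add_mod, Nat.mod_eq_of_lt he]

theorem sum_range_mul_eq_block {M : Type*} [AddCommMonoid M] (f : ℕ → M) (a B i : ℕ) (hi : i < B)
    (hf : ∀ q < B * a, q / a ≠ i → f q = 0) :
    ∑ q ∈ range (B * a), f q = ∑ e : Fin a, f (i * a + e) := by
  rw [← sum_image (f := f) (g := fun e : Fin a => i * a + e) (s := univ)
    (fun e _ e' _ h => Fin.ext (Nat.add_left_cancel h))]
  refine (sum_subset ?_ ?_).symm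
  · intro q hq
    obtain ⟨e, -, rfl⟩ := mem_image.mp hq
    exact mem_range.mpr (block_lt hi e.2)
  · intro q hq hq'
    refine hf q (mem_range.mp hq) fun h => hq' (mem_image.mpr ?_)
    have ha : 0 < a := Nat.pos_of_ne_zero fun h => by simp [h] at hq
    refine ⟨⟨q % a, Nat.mod_lt _ ha⟩, mem_univ _, ?_⟩
    simp only [← h, Nat.div_add_mod']

section ParityCheck

variable {F : Type*} [Field F] {a ℓ ρ : ℕ} {Z : Matrix (Fin a) (Fin (2 * a)) F}
  {C : Matrix (Fin (ℓ * a)) (Fin (ρ - ℓ * a)) F}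

theorem parityCheck_identity (p : Fin (ℓ * a)) (q : Fin (ρ - a + ℓ * a)) (hq : (q : ℕ) < a) :
    parityCheck a ℓ ρ Z C p q = if (p : ℕ) = q then 1 else 0 := by
  simp [parityCheck, hq]

theorem parityCheck_left (p : Fin (ℓ * a)) (q : Fin (ρ - a + ℓ * a)) (e f : Fin a) (i j : ℕ)
    (hp : (p : ℕ) = i * a + e) (hq : (q : ℕ) = j * a + f) (hqa : a ≤ q) (hqℓ : (q : ℕ) < ℓ * a) :
    parityCheck a ℓ ρ Z C p q = if i = j then Z e ⟨f, by omega⟩ else 0 := by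
  simp only [parityCheck, hqa.not_gt, hqℓ, if_true, if_false]
  simp only [hp, hq, block_div e.2, block_mod e.2, block_div f.2, block_mod f.2, Fin.eta]

theorem parityCheck_cauchy (p : Fin (ℓ * a)) (q : Fin (ρ - a + ℓ * a)) (j : Fin (ρ - ℓ * a))
    (hℓ : 1 ≤ ℓ) (hq : (q : ℕ) = ℓ * a + j) : parityCheck a ℓ ρ Z C p q = C p j := by
  have h1 : ¬ (q : ℕ) < a := by
    have := Nat.le_mul_of_pos_left a hℓ
    omega
  have h2 : ¬ (q : ℕ) < ℓ * a := by omega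
  have h3 : ℓ * a ≤ (q : ℕ) ∧ (q : ℕ) < ρ := by omega
  simp only [parityCheck, h1, h2, h3, if_false]
  simp only [hq, and_self, dite_true]
  congr 1
  exact Fin.ext (by simp)

theorem parityCheck_right (p : Fin (ℓ * a)) (q : Fin (ρ - a + ℓ * a)) (e f : Fin a) (i j : ℕ)
    (hℓ : 1 ≤ ℓ) (hρ : ℓ * a ≤ ρ)
    (hp : (p : ℕ) = i * a + e) (hq : (q : ℕ) = ρ + j * a + f) :
    parityCheck a ℓ ρ Z C p q = if i = j + 1 then Z e ⟨a + f, by omega⟩ else 0 := by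
  have h1 : ¬ (q : ℕ) < a := by
    have := Nat.le_mul_of_pos_left a hℓ
    omega
  have h2 : ¬ (q : ℕ) < ℓ * a := by omega
  have h3 : ¬ (ℓ * a ≤ (q : ℕ) ∧ (q : ℕ) < ρ) := by omega
  have h4 : (q : ℕ) - ρ = j * a + f := by omega
  simp only [parityCheck, h1, h2, h3, dif_neg, if_false, not_false_iff]
  simp only [h4, hp, block_div e.2, block_mod e.2, block_div f.2, block_mod f.2, Fin.eta]

end ParityCheck

/-- The parity check in row `e` of block row `i`. -/
theorem baseCode_parity {F : Type*} [Field F] {a ℓ m : ℕ} (hℓ : 1 ≤ ℓ) (hℓm : ℓ ≤ m)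
    {Z : Matrix (Fin a) (Fin (2 * a)) F} {C : Matrix (Fin (ℓ * a)) (Fin ((m + 1) * a - ℓ * a)) F}
    {c : Fin ((m + 1) * a - a + ℓ * a) → F} (hc : c ∈ baseCode a ℓ ((m + 1) * a) Z C)
    (i : ℕ) (e : Fin a) (p : Fin (ℓ * a)) (hp : (p : ℕ) = i * a + e) :
    (if i = 0 then symbol c e else ∑ f : Fin a, Z e ⟨f, by omega⟩ * symbol c (i * a + f)) +
      ∑ j, C p j * symbol c (ℓ * a + j) +
      (if i = 0 then 0 else ∑ f : Fin a, Z e ⟨a + f, by omega⟩ * symbol c ((m + i) * a + f)) = 0 := by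
  have he := e.2
  have hiℓ : i < ℓ := by
    by_contra h
    have := Nat.mul_le_mul_right a (not_lt.mp h)
    have := p.2
    omega
  have hρ : ℓ * a ≤ (m + 1) * a := Nat.mul_le_mul_right a (by omega)
  have hm1 : (m + 1) * a = m * a + a := by ring
  obtain ⟨ℓ', rfl⟩ := Nat.exists_eq_add_of_le' hℓ
  have hℓ1 : (ℓ' + 1) * a = ℓ' * a + a := by ring
  set φ : ℕ → F := fun q => if h : q < (m + 1) * a - a + (ℓ' + 1) * a then
    parityCheck a (ℓ' + 1) ((m + 1) * a) Z C p ⟨q, h⟩ else 0 with hφ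
  have hφv : ∀ q (h : q < (m + 1) * a - a + (ℓ' + 1) * a),
    φ q = parityCheck a (ℓ' + 1) ((m + 1) * a) Z C p ⟨q, h⟩ := fun q h => dif_pos h
  have h0 : ∑ q ∈ range ((m + 1) * a - a + (ℓ' + 1) * a), φ q * symbol c q = 0 := by
    have := congrFun (LinearMap.mem_ker.mp hc) p
    rw [← Fin.sum_univ_eq_sum_range (fun q => φ q * symbol c q)]
    refine Eq.trans (sum_congr rfl fun q _ => ?_) this
    rw [hφv q q.2, symbol_of_lt c q.2]
  -- The columns split into the `I`/`Z₁` part, the Cauchy part and the `Z₂` part. In the last, block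
  -- row `i` sits at `ρ + (i - 1) a = (m + i) a`.
  have hn : (m + 1) * a - a + (ℓ' + 1) * a =
    (ℓ' + 1) * a + (((m + 1) * a - (ℓ' + 1) * a) + ℓ' * a) := by omega
  rw [congrArg range hn, sum_range_add, sum_range_add, ← add_assoc] at h0
  have hdiv : ∀ q, ∃ (j : ℕ) (f : Fin a), q = j * a + f ∧ q / a = j := fun q =>
    ⟨q / a, ⟨q % a, Nat.mod_lt _ (by omega)⟩, (Nat.div_add_mod' q a).symm, rfl⟩
  refine Eq.trans ?_ h0
  congr 1
  · congr 1
    · rw [sum_range_mul_eq_block _ a _ i hiℓ]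
      · split_ifs with hi
        · subst hi
          rw [sum_eq_single e]
          · rw [hφv _ (by omega), parityCheck_identity _ _ (by simp [he]), if_pos hp, one_mul,
              zero_mul, zero_add]
          · intro f _ hfe
            rw [hφv _ (by omega), parityCheck_identity _ _ (by simp), if_neg, zero_mul]
            simp only [hp]
            intro h
            exact hfe (Fin.ext (by omega))
          · simp
        · have hi1 : 1 * a ≤ i * a := Nat.mul_le_mul_right a (by omega)
          refine sum_congr rfl fun f _ => ?_
          have := block_lt hiℓ f.2
          rw [hφv _ (by omega), parityCheck_left p _ e f i i hp rfl
            (by simp only; omega) (by simp only; omega), if_pos rfl]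
      · intro q hq hqi
        obtain ⟨j, f, hqe, hqj⟩ := hdiv q
        rw [hφv q (by omega)]
        by_cases hqa : q < a
        · rw [parityCheck_identity _ _ hqa, if_neg, zero_mul]
          intro h
          refine hqi ?_
          rw [← show (p : ℕ) = q from h, hp, block_div he]
        · rw [parityCheck_left p _ e f i j hp hqe (by simp only; omega) hq, if_neg, zero_mul]
          omega
    · rw [← Fin.sum_univ_eq_sum_range
        (fun j => φ ((ℓ' + 1) * a + j) * symbol c ((ℓ' + 1) * a + j))]
      refine sum_congr rfl fun j _ => ?_
      rw [hφv _ (by omega), parityCheck_cauchy p _ j (by omega) rfl]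
  · have hstart : ∀ x, (ℓ' + 1) * a + ((m + 1) * a - (ℓ' + 1) * a + x) = (m + 1) * a + x := by
      omega
    simp only [hstart]
    have hterm : ∀ (j : ℕ) (f : Fin a), j < ℓ' → φ ((m + 1) * a + (j * a + f)) =
        if i = j + 1 then Z e ⟨a + f, by omega⟩ else 0 := by
      intro j f hj
      have := block_lt hj f.2
      rw [hφv _ (by omega),
        parityCheck_right p _ e f i j (by omega) hρ hp (by simp only; omega)]
    split_ifs with hi
    · refine (sum_eq_zero fun q hq => ?_).symm
      obtain ⟨j, f, hqe, hqj⟩ := hdiv q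
      have hj : j < ℓ' := by rw [← hqj]; exact Nat.div_lt_of_lt_mul (by
        rw [mul_comm]; exact mem_range.mp hq)
      rw [hqe, hterm j f hj, if_neg (by omega), zero_mul]
    · rw [sum_range_mul_eq_block _ a _ (i - 1) (by omega)]
      · refine sum_congr rfl fun f _ => ?_
        rw [hterm _ f (by omega), if_pos (by omega)]
        congr 2
        obtain ⟨i', rfl⟩ := Nat.exists_eq_add_of_le' (Nat.one_le_iff_ne_zero.mpr hi)
        rw [Nat.add_sub_cancel]
        ring
      · intro q hq hqi
        obtain ⟨j, f, hqe, hqj⟩ := hdiv q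
        have hj : j < ℓ' := by rw [← hqj]; exact Nat.div_lt_of_lt_mul (by rw [mul_comm]; exact hq)
        rw [hqe, hterm j f hj, if_neg (by omega), zero_mul]

/-! ### Erasure correction of the base code -/

theorem IsCauchy.eq_zero_of_support {F : Type*} [Field F] {r c : ℕ} {C : Matrix (Fin r) (Fin c) F}
    (hC : IsCauchy C) (R : Finset (Fin r)) (T : Finset (Fin c)) (hRT : #T ≤ #R) (v : Fin c → F)
    (hvT : ∀ j ∉ T, v j = 0) (hv : ∀ i ∈ R, ∑ j, C i j * v j = 0) (j : Fin c) : v j = 0 := by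
  by_cases hj : j ∈ T
  · refine hC.eq_zero_of_vanish R T hRT v (fun i hi => ?_) j hj
    rw [← hv i hi]
    exact sum_subset (subset_univ T) fun l _ hl => by rw [hvT l hl, mul_zero]
  · exact hvT j hj

theorem sum_fin_two_mul {M : Type*} [AddCommMonoid M] {a : ℕ} (f : Fin (2 * a) → M) :
    ∑ j, f j = ∑ e : Fin a, f ⟨e, by omega⟩ + ∑ e : Fin a, f ⟨a + e, by omega⟩ := by
  rw [← (finCongr (two_mul a).symm).sum_comp, Fin.sum_univ_add]
  rfl

theorem IsZeroBandMDS.sum_left {F : Type*} [Field F] {a : ℕ} {Z : Matrix (Fin a) (Fin (2 * a)) F}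
    (hZ : IsZeroBandMDS Z) (e : Fin a) (v : ℕ → F) (hv : ∀ f < (e : ℕ), v f = 0) :
    ∑ f : Fin a, Z e ⟨f, by omega⟩ * v f = Z e ⟨e, by omega⟩ * v e := by
  refine sum_eq_single e (fun f _ hf => ?_) (by simp)
  have hf' : (f : ℕ) ≠ e := fun h => hf (Fin.ext h)
  by_cases h : (f : ℕ) < e
  · rw [hv f h, mul_zero]
  · rw [hZ.apply_eq_zero_left e _ (by simp only; omega) (by simp only; omega), zero_mul]

theorem IsZeroBandMDS.sum_right {F : Type*} [Field F] {a : ℕ} {Z : Matrix (Fin a) (Fin (2 * a)) F}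
    (hZ : IsZeroBandMDS Z) (e : Fin a) (v : ℕ → F) (hv : ∀ f, (e : ℕ) ≤ f → f < a → v f = 0) :
    ∑ f : Fin a, Z e ⟨a + f, by omega⟩ * v f = 0 := by
  refine sum_eq_zero fun f _ => ?_
  by_cases h : (f : ℕ) < e
  · rw [hZ.apply_eq_zero_left e _ (by simp only; omega) (by simp only; omega), zero_mul]
  · rw [hv f (by omega) f.2, mul_zero]

section Decoding

variable {F : Type*} [Field F] {a ℓ m : ℕ} {Z : Matrix (Fin a) (Fin (2 * a)) F}
  {C : Matrix (Fin (ℓ * a)) (Fin ((m + 1) * a - ℓ * a)) F}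
  {c : Fin ((m + 1) * a - a + ℓ * a) → F}

/-- By triangularity, what remains of check `p` besides symbol `p` and the Cauchy symbols has index
below `p` or at least `p + m a`. The former precede the burst; the latter follow it and arrive in
time, because `p ≤ J`. -/
theorem burst_checks (hℓ : 1 ≤ ℓ) (hℓm : ℓ ≤ m) (hZ : IsZeroBandMDS Z)
    (hc : c ∈ baseCode a ℓ ((m + 1) * a) Z C) {J : ℕ}
    (h0 : ∀ q < J, symbol c q = 0)
    (h1 : ∀ q, J + ℓ * a ≤ q → q < (m + J / a + 1) * a → symbol c q = 0)
    (p : Fin (ℓ * a)) (hpJ : (p : ℕ) ≤ J) (hp : (p : ℕ) < a ∨ J + ℓ * a ≤ p + m * a) :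
    ∃ z : F, z ≠ 0 ∧ z * symbol c p + ∑ j, C p j * symbol c (ℓ * a + j) = 0 := by
  have ha := pos_of_row p
  obtain ⟨i, e, hie⟩ : ∃ (i : ℕ) (e : Fin a), (p : ℕ) = i * a + e :=
    ⟨p / a, ⟨p % a, Nat.mod_lt _ ha⟩, (Nat.div_add_mod' _ a).symm⟩
  have he := e.2
  have hpar := baseCode_parity hℓ hℓm hc i e p hie
  split_ifs at hpar with hi
  · refine ⟨1, one_ne_zero, ?_⟩
    rw [one_mul, hie, hi, zero_mul, zero_add]
    rwa [add_zero] at hpar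
  · refine ⟨_, hZ.diag_ne_zero e ⟨e, by omega⟩ rfl, ?_⟩
    rw [hZ.sum_left e (fun f => symbol c (i * a + f)) fun f hf => h0 _ (by omega),
      hZ.sum_right e (fun f => symbol c ((m + i) * a + f)), add_zero, ← hie] at hpar
    · exact hpar
    · intro f hef hfa
      have hia : 1 * a ≤ i * a := Nat.mul_le_mul_right a (by omega)
      have hmi : (m + i) * a = m * a + i * a := add_mul _ _ _
      have hiJ : i ≤ J / a := (Nat.le_div_iff_mul_le ha).mpr (by omega)
      refine h1 _ (by omega) (block_lt (by omega) hfa)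

/-- A burst of `ℓ a` consecutive erasures, together with late symbols which are not available. -/
theorem burst_cauchy (ha : 0 < a) (hℓ : 1 ≤ ℓ) (hℓm : ℓ ≤ m) (hZ : IsZeroBandMDS Z)
    (hC : IsCauchy C) (hc : c ∈ baseCode a ℓ ((m + 1) * a) Z C) {J : ℕ} (hJ : J ≤ m * a)
    (h0 : ∀ q < J, symbol c q = 0)
    (h1 : ∀ q, J + ℓ * a ≤ q → q < (m + J / a + 1) * a → symbol c q = 0)
    (j : Fin ((m + 1) * a - ℓ * a)) : symbol c (ℓ * a + j) = 0 := by
  have hm1 : (m + 1) * a = m * a + a := by ring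
  have hℓma : ℓ * a ≤ m * a := Nat.mul_le_mul_right a hℓm
  have hℓa : a ≤ ℓ * a := Nat.le_mul_of_pos_left a hℓ
  -- `R` holds the checks whose own symbol is known to vanish, `T` the Cauchy symbols inside the
  -- burst.
  set R : Finset (Fin (ℓ * a)) := {p | (p : ℕ) < J ∧ ((p : ℕ) < a ∨ J + ℓ * a ≤ p + m * a)} with hR
  set T : Finset (Fin ((m + 1) * a - ℓ * a)) := {j | J ≤ ℓ * a + j ∧ (j : ℕ) < J} with hT
  have hTc : #T ≤ min J ((m + 1) * a - ℓ * a) - (J - ℓ * a) := by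
    rw [← card_map Fin.valEmbedding]
    refine le_of_le_of_eq (card_le_card fun x hx => ?_)
      (Nat.card_Ico (J - ℓ * a) (min J ((m + 1) * a - ℓ * a)))
    obtain ⟨l, hl, rfl⟩ := mem_map.mp hx
    have hl' := (mem_filter.mp hl).2
    simp only [Fin.valEmbedding_apply, mem_Ico]
    omega
  have hmemR : ∀ x, x < ℓ * a → x < J → (x < a ∨ J + ℓ * a ≤ x + m * a) →
      x ∈ R.map Fin.valEmbedding := fun x h1 h2 h3 =>
    mem_map.mpr ⟨⟨x, h1⟩, mem_filter.mpr ⟨mem_univ _, h2, h3⟩, rfl⟩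
  have hRc : #T ≤ #R := by
    refine hTc.trans ?_
    rw [← card_map Fin.valEmbedding (s := R)]
    by_cases hL : J + ℓ * a < m * a + a
    · have : range (min J (ℓ * a)) ⊆ R.map Fin.valEmbedding := by
        intro x hx
        rw [mem_range] at hx
        exact hmemR x (by omega) (by omega) (by omega)
      have := card_le_card this
      rw [card_range] at this
      omega
    -- The burst reaches the end of the Cauchy part. Checks from `a` up to `J + ℓ a - m a` are lost,
    -- and the remaining `(m + 1) a - max J (ℓ a)` are exactly as many as the unknowns.
    · have : range a ∪ Ico (J + ℓ * a - m * a) (min J (ℓ * a)) ⊆ R.map Fin.valEmbedding := by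
        intro x hx
        rw [mem_union, mem_range, mem_Ico] at hx
        exact hmemR x (by omega) (by omega) (by omega)
      have := card_le_card this
      rw [card_union_of_disjoint, card_range, Nat.card_Ico] at this
      · omega
      · rw [Finset.disjoint_left]
        intro x hx hx'
        rw [mem_range] at hx
        rw [mem_Ico] at hx'
        omega
  refine hC.eq_zero_of_support R T hRc (fun j => symbol c (ℓ * a + j)) (fun j hj => ?_)
    (fun p hp => ?_) j
  · have : ¬ (J ≤ ℓ * a + j ∧ (j : ℕ) < J) := fun h => hj (mem_filter.mpr ⟨mem_univ _, h⟩)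
    by_cases h : ℓ * a + j < J
    · exact h0 _ h
    · have hj2 := j.2
      have : (m + 1) * a ≤ (m + J / a + 1) * a :=
        Nat.mul_le_mul_right a (Nat.add_le_add_right (Nat.le_add_right _ _) 1)
      exact h1 _ (by omega) (by omega)
  · have hp' := (mem_filter.mp hp).2
    obtain ⟨z, -, hz⟩ := burst_checks hℓ hℓm hZ hc h0 h1 p (by omega) hp'.2
    rwa [h0 _ hp'.1, mul_zero, zero_add] at hz

theorem burst_first (ha : 0 < a) (hℓ : 1 ≤ ℓ) (hℓm : ℓ ≤ m) (hZ : IsZeroBandMDS Z)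
    (hC : IsCauchy C) (hc : c ∈ baseCode a ℓ ((m + 1) * a) Z C) {J : ℕ} (hJ : J ≤ m * a)
    (h0 : ∀ q < J, symbol c q = 0)
    (h1 : ∀ q, J + ℓ * a ≤ q → q < (m + J / a + 1) * a → symbol c q = 0) : symbol c J = 0 := by
  have hcau := burst_cauchy ha hℓ hℓm hZ hC hc hJ h0 h1
  have hm1 : (m + 1) * a = m * a + a := by ring
  have hℓma : ℓ * a ≤ m * a := Nat.mul_le_mul_right a hℓm
  by_cases h : J < ℓ * a
  · obtain ⟨z, hz, hsum⟩ := burst_checks hℓ hℓm hZ hc h0 h1 ⟨J, h⟩ le_rfl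
      (Or.inr (by simp only; omega))
    simp only [hcau, mul_zero, sum_const_zero, add_zero] at hsum
    exact (mul_eq_zero.mp hsum).resolve_left hz
  · have := hcau ⟨J - ℓ * a, by omega⟩
    rwa [Nat.add_sub_cancel' (by omega)] at this

/-- Without the Cauchy terms, block row `i` says that blocks `i` and `m + i` together lie in the
kernel of `Z`, any `a` columns of which are independent. -/
theorem block_eq_zero (hℓ : 1 ≤ ℓ) (hℓm : ℓ ≤ m) (hZ : IsZeroBandMDS Z)
    (hc : c ∈ baseCode a ℓ ((m + 1) * a) Z C)
    (hcau : ∀ j : Fin ((m + 1) * a - ℓ * a), symbol c (ℓ * a + j) = 0)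
    {i : ℕ} (hi : 1 ≤ i) (hiℓ : i < ℓ) (W : Finset ℕ) (hW : #W ≤ a)
    (hW1 : ∀ f < a, symbol c (i * a + f) ≠ 0 → i * a + f ∈ W)
    (hW2 : ∀ f < a, symbol c ((m + i) * a + f) ≠ 0 → (m + i) * a + f ∈ W) :
    ∀ f < a, symbol c (i * a + f) = 0 ∧ symbol c ((m + i) * a + f) = 0 := by
  classical
  let pos (j : Fin (2 * a)) : ℕ := if (j : ℕ) < a then i * a + j else (m + i) * a + (j - a)
  have hpos1 : ∀ (f : ℕ) (h : f < a), pos ⟨f, by omega⟩ = i * a + f := fun f h => if_pos h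
  have hpos2 : ∀ (f : ℕ) (h : f < a), pos ⟨a + f, by omega⟩ = (m + i) * a + f := fun f h => by
    simp [pos]
  have hinj : Function.Injective pos := by
    intro j j' h
    have : (i + 1) * a ≤ (m + i) * a := Nat.mul_le_mul_right a (by omega)
    rw [add_mul, one_mul] at this
    simp only [pos] at h
    refine Fin.ext ?_
    split_ifs at h <;> omega
  have hv : (fun j => symbol c (pos j)) = 0 := by
    refine hZ.1.eq_zero_of_mulVec (by omega) {j | symbol c (pos j) ≠ 0} ?_ _ ?_ ?_
    · refine le_trans ?_ hW
      rw [← card_image_of_injective _ hinj]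
      refine card_le_card fun x hx => ?_
      obtain ⟨j, hj, rfl⟩ := mem_image.mp hx
      have hj' := (mem_filter.mp hj).2
      have hj2 := j.2
      by_cases h : (j : ℕ) < a
      · simp only [pos, if_pos h] at hj' ⊢
        exact hW1 _ h hj'
      · simp only [pos, if_neg h] at hj' ⊢
        exact hW2 _ (by omega) hj'
    · intro j hj
      by_contra h
      exact hj (mem_filter.mpr ⟨mem_univ _, h⟩)
    · intro e
      have hpar := baseCode_parity hℓ hℓm hc i e ⟨i * a + e, block_lt hiℓ e.2⟩ rfl
      simp only [hcau, mul_zero, sum_const_zero, add_zero, if_neg (show i ≠ 0 by omega)] at hpar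
      rw [sum_fin_two_mul, ← hpar]
      congr 1 <;> refine sum_congr rfl fun f _ => ?_
      · rw [hpos1 f f.2]
      · rw [hpos2 f f.2]
  intro f hf
  rw [← hpos1 f hf, ← hpos2 f hf]
  exact ⟨congrFun hv _, congrFun hv _⟩

/-- At most `a` erasures, together with late symbols which are not available. -/
theorem sparse_first (ha : 0 < a) (hℓ : 1 ≤ ℓ) (hℓm : ℓ ≤ m) (hZ : IsZeroBandMDS Z)
    (hC : IsCauchy C) (hc : c ∈ baseCode a ℓ ((m + 1) * a) Z C) {J : ℕ} (hJ : J < m * a)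
    (h0 : ∀ q < J, symbol c q = 0) (D : Finset ℕ) (hD : #D ≤ a)
    (h1 : ∀ q, J ≤ q → q < (m + J / a + 1) * a → symbol c q ≠ 0 → q ∈ D) : symbol c J = 0 := by
  classical
  have hm1 : (m + 1) * a = m * a + a := by ring
  have hmJ : (m + 1) * a ≤ (m + J / a + 1) * a :=
    Nat.mul_le_mul_right a (Nat.add_le_add_right (Nat.le_add_right _ _) 1)
  have hℓma : ℓ * a ≤ m * a := Nat.mul_le_mul_right a hℓm
  have hℓa : a ≤ ℓ * a := Nat.le_mul_of_pos_left a hℓ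
  have hmem : ∀ q, q < (m + J / a + 1) * a → symbol c q ≠ 0 → q ∈ D := fun q hq hne =>
    h1 q (not_lt.mp fun h => hne (h0 q h)) hq hne
  have hcau : ∀ j : Fin ((m + 1) * a - ℓ * a), symbol c (ℓ * a + j) = 0 := by
    -- Each nonzero symbol of block `0` costs one pure Cauchy check but also uses up one of the `a`
    -- erasures, so `#T ≤ #R`.
    set R : Finset (Fin (ℓ * a)) := {p | (p : ℕ) < a ∧ symbol c p = 0} with hR
    set T : Finset (Fin ((m + 1) * a - ℓ * a)) := {j | symbol c (ℓ * a + j) ≠ 0} with hT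
    have hT' : T.image (fun j : Fin ((m + 1) * a - ℓ * a) => ℓ * a + (j : ℕ)) ∪
        {p ∈ range a | ¬ symbol c p = 0} ⊆ D := by
      intro q hq
      rcases mem_union.mp hq with h | h
      · obtain ⟨j, hj, rfl⟩ := mem_image.mp h
        have hj2 := j.2
        exact hmem _ (by omega) (mem_filter.mp hj).2
      · obtain ⟨hqa, hq0⟩ := mem_filter.mp h
        have := mem_range.mp hqa
        exact hmem _ (by omega) hq0
    have hTc := (card_le_card hT').trans hD
    rw [card_union_of_disjoint, card_image_of_injective] at hTc
    · have hRc : #{p ∈ range a | symbol c p = 0} ≤ #R := by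
        rw [← card_map Fin.valEmbedding (s := R)]
        refine card_le_card fun q hq => ?_
        obtain ⟨hqa, hq0⟩ := mem_filter.mp hq
        have := mem_range.mp hqa
        exact mem_map.mpr ⟨⟨q, by omega⟩, mem_filter.mpr ⟨mem_univ _, this, hq0⟩, rfl⟩
      have := card_filter_add_card_filter_not (s := range a) (fun p => symbol c p = 0)
      rw [card_range] at this
      refine hC.eq_zero_of_support R T (by omega) (fun j => symbol c (ℓ * a + j)) (fun j hj => ?_)
        fun p hp => ?_
      · by_contra h
        exact hj (mem_filter.mpr ⟨mem_univ _, h⟩)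
      · obtain ⟨hpa, hp0⟩ := (mem_filter.mp hp).2
        simpa [hp0] using baseCode_parity hℓ hℓm hc 0 ⟨p, hpa⟩ p (by simp)
    · intro j j' h
      exact Fin.ext (Nat.add_left_cancel h)
    · rw [Finset.disjoint_left]
      intro q hq hq'
      obtain ⟨j, hj, rfl⟩ := mem_image.mp hq
      have := mem_range.mp (mem_filter.mp hq').1
      omega
  by_cases hJℓ : ℓ * a ≤ J
  · have := hcau ⟨J - ℓ * a, by omega⟩
    rwa [Nat.add_sub_cancel' hJℓ] at this
  · have hJd : J = J / a * a + J % a := (Nat.div_add_mod' J a).symm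
    have hmod := Nat.mod_lt J ha
    by_cases hi : J / a = 0
    · have hJa : J < a := by rw [hi] at hJd; omega
      simpa [hcau] using baseCode_parity hℓ hℓm hc 0 ⟨J, hJa⟩ ⟨J, by omega⟩ (by simp)
    · have hiℓ : J / a < ℓ := Nat.div_lt_of_lt_mul (by rw [mul_comm]; omega)
      have := (block_eq_zero hℓ hℓm hZ hc hcau (Nat.one_le_iff_ne_zero.mpr hi) hiℓ D hD
        (fun f hf => hmem _ (block_lt (by omega) hf))
        (fun f hf => hmem _ (block_lt (Nat.lt_succ_self _) hf)) (J % a) hmod).1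
      rwa [← hJd] at this

/-- The `ℓ a` parity symbols form a burst starting at `J = m a`, which clears the Cauchy symbols.
Since `ℓ ≤ m`, each block `i < ℓ` is already zero, so block `m + i` has weight at most `a`. -/
theorem baseCode_eq_zero (ha : 0 < a) (hℓ : 1 ≤ ℓ) (hℓm : ℓ ≤ m) (hZ : IsZeroBandMDS Z)
    (hC : IsCauchy C) (hc : c ∈ baseCode a ℓ ((m + 1) * a) Z C)
    (h0 : ∀ q < m * a, symbol c q = 0) (q : ℕ) : symbol c q = 0 := by
  have hm1 : (m + 1) * a = m * a + a := by ring
  have hℓma : ℓ * a ≤ m * a := Nat.mul_le_mul_right a hℓm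
  have hcau := burst_cauchy ha hℓ hℓm hZ hC hc le_rfl h0
    fun q hq _ => symbol_of_le c (by omega)
  by_cases hq : q < m * a
  · exact h0 q hq
  by_cases hq1 : q < (m + 1) * a
  · have := hcau ⟨q - ℓ * a, by omega⟩
    rwa [Nat.add_sub_cancel' (by omega)] at this
  by_cases hqn : q < (m + ℓ) * a
  · have hqd : q / a * a + q % a = q := Nat.div_add_mod' q a
    have h1 : m + 1 ≤ q / a := (Nat.le_div_iff_mul_le ha).mpr (by omega)
    have h2 : q / a < m + ℓ := Nat.div_lt_of_lt_mul (by rw [mul_comm]; exact hqn)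
    obtain ⟨i, hi⟩ := Nat.exists_eq_add_of_le (show m ≤ q / a by omega)
    have hiℓ : i < ℓ := by omega
    have := (block_eq_zero hℓ hℓm hZ hc hcau (i := i) (by omega) hiℓ
      (Ico ((m + i) * a) ((m + i) * a + a)) (by simp)
      (fun f hf h => absurd (h0 _ ((block_lt hiℓ hf).trans_le hℓma)) h)
      (fun f hf _ => mem_Ico.mpr (by omega)) (q % a) (Nat.mod_lt q ha)).2
    rwa [← hi, hqd] at this
  · exact symbol_of_le c (by rw [add_mul] at hqn; omega)

end Decoding

theorem baseCode_isInfoPrefix {F : Type*} [Field F] {a ℓ m : ℕ} (ha : 0 < a) (hℓ : 1 ≤ ℓ)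
    (hℓm : ℓ ≤ m) {Z : Matrix (Fin a) (Fin (2 * a)) F}
    {C : Matrix (Fin (ℓ * a)) (Fin ((m + 1) * a - ℓ * a)) F} (hZ : IsZeroBandMDS Z)
    (hC : IsCauchy C) : IsInfoPrefix (baseCode a ℓ ((m + 1) * a) Z C) ((m + 1) * a - a) := by
  have hm1 : (m + 1) * a = m * a + a := by ring
  refine ⟨by omega, ?_⟩
  let ψ : baseCode a ℓ ((m + 1) * a) Z C →ₗ[F] (Fin ((m + 1) * a - a) → F) :=
    LinearMap.funLeft F F (Fin.castLE (by omega)) ∘ₗ Submodule.subtype _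
  have hinj : Function.Injective ψ := by
    rw [← LinearMap.ker_eq_bot, LinearMap.ker_eq_bot']
    intro c hc
    have h := baseCode_eq_zero ha hℓ hℓm hZ hC c.2 fun q hq => by
      rw [symbol_of_lt _ (by omega)]
      exact congrFun hc ⟨q, by omega⟩
    refine Subtype.ext (funext fun q => ?_)
    exact (symbol_of_lt (c : _ → F) q.2).symm.trans (h q)
  have hle := LinearMap.finrank_le_finrank_of_injective hinj
  -- With `ℓ a` checks the kernel has dimension at least `m a`, and injectivity gives the reverse
  -- inequality.
  have hrank := LinearMap.finrank_range_add_finrank_ker (parityCheck a ℓ ((m + 1) * a) Z C).mulVecLin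
  have hrange := Submodule.finrank_le (LinearMap.range (parityCheck a ℓ ((m + 1) * a) Z C).mulVecLin)
  rw [Module.finrank_fin_fun] at hle hrank hrange
  have hker : Module.finrank F (LinearMap.ker (parityCheck a ℓ ((m + 1) * a) Z C).mulVecLin) =
    Module.finrank F (baseCode a ℓ ((m + 1) * a) Z C) := rfl
  exact ⟨hinj, (LinearMap.injective_iff_surjective_of_finrank_eq_finrank
    (by rw [Module.finrank_fin_fun]; omega)).mp hinj⟩

/-! ### The encoder of a staggered diagonal embedding -/

theorem extendZero_natCast {F : Type*} [Zero F] {n : ℕ} (x : ℕ → Fin n → F) (t : ℕ) :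
    extendZero x t = x t := by
  simp [extendZero]

theorem extendZero_of_neg {F : Type*} [Zero F] {n : ℕ} (x : ℕ → Fin n → F) {t : ℤ} (ht : t < 0) :
    extendZero x t = 0 := if_neg ht.not_ge

theorem extendZero_eq_zero {F : Type*} [Zero F] {n : ℕ} (x : ℕ → Fin n → F) {t : ℤ}
    (h : ∀ s : ℕ, (s : ℤ) = t → x s = 0) : extendZero x t = 0 := by
  rcases lt_or_ge t 0 with ht | ht
  · exact extendZero_of_neg x ht
  · obtain ⟨s, rfl⟩ := Int.eq_ofNat_of_zero_le ht
    exact (extendZero_natCast x s).trans (h s rfl)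

theorem sub_mem_SDE {F : Type*} [Field F] {n : ℕ} {C : Submodule F (Fin n → F)} {S : Finset ℕ}
    {x y : ℕ → Fin n → F} (hx : x ∈ SDE C S) (hy : y ∈ SDE C S) : x - y ∈ SDE C S := by
  intro t
  convert C.sub_mem (hx t) (hy t) using 1
  funext i
  simp only [extendZero, Pi.sub_apply]
  split_ifs <;> simp

/-- Encode each diagonal separately. Causality holds because the placement is increasing: the
message symbols of a diagonal precede its parity symbols. -/
theorem exists_isEncoder_range_eq_SDE {F : Type*} [Field F] {n k : ℕ} {C : Submodule F (Fin n → F)}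
    (hC : IsInfoPrefix C k) (S : Finset ℕ)
    (hS : ∀ i j : ℕ, i < j → j < n → place S i < place S j) :
    ∃ enc : (ℕ → Fin k → F) → ℕ → Fin n → F, IsEncoder enc ∧ Set.range enc = SDE C S := by
  obtain ⟨hkn, hbij⟩ := hC
  choose G hG using hbij.surjective
  have hGv : ∀ v (i : Fin k), (G v : Fin n → F) (Fin.castLE hkn i) = v i := fun v i =>
    congrFun (hG v) i
  have huniq : ∀ c (hc : c ∈ C) v, (∀ i : Fin k, c (Fin.castLE hkn i) = v i) → c = G v := by
    intro c hc v h
    exact congrArg Subtype.val (hbij.injective (a₁ := ⟨c, hc⟩) ((funext h).trans (hG v).symm))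
  let msg (u : ℕ → Fin k → F) (t : ℤ) : Fin k → F := fun l => extendZero u (t + place S l) l
  let enc (u : ℕ → Fin k → F) (t : ℕ) : Fin n → F := fun j =>
    (G (msg u (t - place S j)) : Fin n → F) j
  have hsys : ∀ u t (i : Fin k), enc u t (Fin.castLE hkn i) = u t i := by
    intro u t i
    change (G _ : Fin n → F) (Fin.castLE hkn i) = _
    rw [hGv]
    simp only [msg, Fin.val_castLE, sub_add_cancel, extendZero_natCast]
  have hdiag : ∀ u (t : ℤ),
      (fun j : Fin n => extendZero (enc u) (t + place S j) j) = G (msg u t) := by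
    intro u t
    funext j
    rcases lt_or_ge (t + place S j) 0 with h | h
    · rw [extendZero_of_neg _ h]
      by_cases hj : (j : ℕ) < k
      · have := hGv (msg u t) ⟨j, hj⟩
        refine Eq.trans ?_ this.symm
        simp only [msg]
        rw [extendZero_of_neg _ h]
        rfl
      -- A parity symbol at negative time has all its message symbols at negative times, so the zero
      -- extension is consistent.
      · have hmsg : msg u t = 0 := by
          funext l
          have := hS l j (by omega) j.2
          simp only [msg]
          rw [extendZero_of_neg _ (by omega)]
        rw [hmsg, ← huniq 0 C.zero_mem 0 fun _ => rfl]
    · obtain ⟨s, hs⟩ := Int.eq_ofNat_of_zero_le h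
      rw [hs]
      rw [extendZero_natCast]
      simp only [enc]
      rw [show (s : ℤ) - place S j = t from by
        change t + place S j = (s : ℤ) at hs
        omega]
  refine ⟨enc, ⟨hkn, hsys, ?_⟩, Set.Subset.antisymm ?_ ?_⟩
  · intro u u' t h
    funext j
    by_cases hj : (j : ℕ) < k
    · exact (hsys u t ⟨j, hj⟩).trans ((congrFun (h t le_rfl) _).trans (hsys u' t ⟨j, hj⟩).symm)
    · have hmsg : msg u (t - place S j) = msg u' (t - place S j) := by
        funext l
        have := hS l j (by omega) j.2
        simp only [msg, extendZero]
        split_ifs with h0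
        · rw [h _ (by omega)]
        · rfl
      simp only [enc, hmsg]
  · rintro _ ⟨u, rfl⟩ t
    rw [hdiag]
    exact (G _).2
  · intro x hx
    refine ⟨fun t i => x t (Fin.castLE hkn i), ?_⟩
    funext t j
    have := huniq _ (hx (t - place S j)) (msg (fun t i => x t (Fin.castLE hkn i)) (t - place S j))
      fun i => by
        simp only [msg, extendZero, Fin.val_castLE]
        split_ifs <;> rfl
    refine (congrFun this j).symm.trans ?_
    simp only [sub_add_cancel, extendZero_natCast]

/-- A staggered diagonal embedding is a streaming code if it can recover the first nonzero packet
of a stream. -/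
theorem isStreamingCode_SDE {F : Type*} [Field F] {n k a b τ : ℕ} {C : Submodule F (Fin n → F)}
    (hC : IsInfoPrefix C k) (S : Finset ℕ)
    (hS : ∀ i j : ℕ, i < j → j < n → place S i < place S j)
    (hdec : ∀ x ∈ SDE C S, ∀ E, IsAdmissible a b τ E → ∀ t ∈ E, (∀ s < t, x s = 0) →
      (∀ s ≤ t + τ, s ∉ E → x s = 0) → ∀ j : Fin n, (j : ℕ) < k → x t j = 0) :
    IsStreamingCode a b τ k (SDE C S) := by
  obtain ⟨enc, henc, hrange⟩ := exists_isEncoder_range_eq_SDE hC S hS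
  refine ⟨enc, henc, hrange, fun E hE t u u' => ?_⟩
  induction t using Nat.strong_induction_on with
  | _ t ih =>
    intro h
    have hpast : ∀ s < t, u s = u' s := fun s hs => ih s hs fun r hr => h r (by omega)
    funext i
    rw [← henc.systematic u t i, ← henc.systematic u' t i]
    by_cases htE : t ∈ E
    · have hmem : ∀ v, enc v ∈ SDE C S := fun v => hrange ▸ Set.mem_range_self v
      have := hdec _ (sub_mem_SDE (hmem u) (hmem u')) E hE t htE
        (fun s hs => sub_eq_zero.mpr (henc.causal u u' s fun r hr => hpast r (by omega)))
        (fun s hs hsE => sub_eq_zero.mpr (h s hs hsE)) (Fin.castLE henc.le i) i.2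
      exact sub_eq_zero.mp this
    · rw [h t (by omega) htE]

/-! ### The block placement set -/

/-- The `q`-th element of the union of blocks of length `a` starting at the multiples of `d`. -/
def blockPlace (a d q : ℕ) : ℕ := q / a * d + q % a

theorem blockPlace_strictMono {a d : ℕ} (ha : 0 < a) (had : a ≤ d) :
    StrictMono (blockPlace a d) := by
  intro q q' h
  simp only [blockPlace]
  rcases (Nat.div_le_div_right (c := a) h.le).eq_or_lt with h1 | h1
  · have h2 := Nat.div_add_mod' q a
    have h3 := Nat.div_add_mod' q' a
    rw [h1] at h2 ⊢
    omega
  · have h2 := Nat.mul_le_mul_right d (Nat.succ_le_of_lt h1)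
    rw [Nat.succ_mul] at h2
    have := Nat.mod_lt q ha
    omega

theorem place_image {f : ℕ → ℕ} (hf : StrictMono f) {n i : ℕ} (hi : i < n) :
    place ((range n).image f) i = f i := by
  classical
  have hmem : f i ∈ (range n).image f := mem_image_of_mem f (mem_range.mpr hi)
  have hcount : Nat.count (fun j => j ∈ (range n).image f) (f i) = i := by
    rw [Nat.count_eq_card_filter_range]
    have : {x ∈ range (f i) | x ∈ (range n).image f} = (range i).image f := by
      ext x
      simp only [mem_filter, mem_range, mem_image]
      constructor
      · rintro ⟨hx, j, hj, rfl⟩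
        exact ⟨j, hf.lt_iff_lt.mp hx, rfl⟩
      · rintro ⟨j, hj, rfl⟩
        exact ⟨hf hj, j, by omega, rfl⟩
    rw [this, card_image_of_injective _ hf.injective, card_range]
  have := Nat.nth_count (p := fun j => j ∈ (range n).image f) hmem
  rw [hcount] at this
  exact this

theorem biUnion_Ico_eq_image {a d B : ℕ} (ha : 0 < a) :
    ((range B).biUnion fun i => Ico (i * d) (i * d + a)) = (range (B * a)).image (blockPlace a d) := by
  ext x
  simp only [mem_biUnion, mem_range, mem_Ico, mem_image, blockPlace]
  constructor
  · rintro ⟨i, hi, h1, h2⟩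
    obtain ⟨e, rfl⟩ := Nat.exists_eq_add_of_le h1
    have he : e < a := by omega
    exact ⟨i * a + e, block_lt hi he, by rw [block_div he, block_mod he]⟩
  · rintro ⟨q, hq, rfl⟩
    have := Nat.mod_lt q ha
    exact ⟨q / a, Nat.div_lt_of_lt_mul (by rwa [mul_comm]), by omega, by omega⟩

theorem isPlacementSet_biUnion {a d B : ℕ} (ha : 0 < a) (had : a ≤ d) (hB : 1 ≤ B) :
    IsPlacementSet (B * a) ((B - 1) * d + a)
      ((range B).biUnion fun i => Ico (i * d) (i * d + a)) := by
  refine ⟨?_, ?_, ?_, ?_⟩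
  · rw [biUnion_Ico_eq_image ha, card_image_of_injective _ (blockPlace_strictMono ha had).injective,
      card_range]
  · intro x hx
    obtain ⟨i, hi, hx⟩ := mem_biUnion.mp hx
    rw [mem_range] at hi ⊢
    rw [mem_Ico] at hx
    have := Nat.mul_le_mul_right d (show i ≤ B - 1 by omega)
    omega
  · exact mem_biUnion.mpr ⟨0, mem_range.mpr hB, mem_Ico.mpr (by omega)⟩
  · exact mem_biUnion.mpr ⟨B - 1, mem_range.mpr (by omega), mem_Ico.mpr (by omega)⟩

/-! ### The streaming property -/

theorem isStreamingCode_baseCode {F : Type*} [Field F] {a b τ d ℓ m : ℕ} (ha : 0 < a) (had : a ≤ d)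
    (hℓ : 1 ≤ ℓ) (hℓm : ℓ ≤ m) (hb : b = ℓ * d) (hτ : τ + 1 = m * d + a)
    {Z : Matrix (Fin a) (Fin (2 * a)) F} {C : Matrix (Fin (ℓ * a)) (Fin ((m + 1) * a - ℓ * a)) F}
    (hZ : IsZeroBandMDS Z) (hC : IsCauchy C) :
    IsStreamingCode a b τ ((m + 1) * a - a) (SDE (baseCode a ℓ ((m + 1) * a) Z C)
      ((range (m + ℓ)).biUnion fun i => Ico (i * d) (i * d + a))) := by
  classical
  have hm1 : (m + 1) * a = m * a + a := by ring
  have hmono := blockPlace_strictMono ha had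
  have hn : (m + 1) * a - a + ℓ * a = (m + ℓ) * a := by rw [add_mul m ℓ]; omega
  rw [biUnion_Ico_eq_image ha]
  have hplace : ∀ q, q < (m + 1) * a - a + ℓ * a →
      place ((range ((m + ℓ) * a)).image (blockPlace a d)) q = blockPlace a d q := fun q hq =>
    place_image hmono (by omega)
  refine isStreamingCode_SDE (baseCode_isInfoPrefix ha hℓ hℓm hZ hC) _ (fun i j hij hj => ?_) ?_
  · rw [hplace i (by omega), hplace j hj]
    exact hmono hij
  intro x hx E hE t htE hpast hrec J hJk
  -- The diagonal whose symbol `J` lies in packet `t`.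
  set c : Fin ((m + 1) * a - a + ℓ * a) → F := fun q =>
    extendZero x ((t : ℤ) - blockPlace a d J + blockPlace a d q) q with hcdef
  have hc : c ∈ baseCode a ℓ ((m + 1) * a) Z C := by
    convert hx (t - blockPlace a d J) using 1
    funext q
    rw [hplace q q.2]
  have hval : ∀ q, symbol c q ≠ 0 → ∃ s : ℕ, s + blockPlace a d J = t + blockPlace a d q ∧
      x s ≠ 0 := by
    intro q hq
    have hqn : q < (m + 1) * a - a + ℓ * a := by
      by_contra h
      exact hq (symbol_of_le c (by omega))
    rw [symbol_of_lt c hqn] at hq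
    by_contra! hall
    refine hq (congrFun (extendZero_eq_zero x fun s hs => hall s ?_) _)
    simp only at hs
    omega
  have h0 : ∀ q < (J : ℕ), symbol c q = 0 := by
    intro q hq
    by_contra h
    obtain ⟨s, hs, hxs⟩ := hval q h
    have := hmono hq
    exact hxs (hpast s (by omega))
  -- Through block `m + J / a` the time offset from symbol `J` is at most `m d + a - 1 = τ`, so a
  -- nonzero symbol there must have been erased.
  have hwin : ∀ q, (J : ℕ) ≤ q → q < (m + (J : ℕ) / a + 1) * a → symbol c q ≠ 0 →
      ∃ s : ℕ, s + blockPlace a d J = t + blockPlace a d q ∧ s ∈ E ∩ Set.Icc t (t + τ) := by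
    intro q hq hq' h
    obtain ⟨s, hs, hxs⟩ := hval q h
    have h1 := hmono.monotone hq
    have h2 : q / a ≤ m + (J : ℕ) / a :=
      Nat.lt_succ_iff.mp (Nat.div_lt_of_lt_mul (by rwa [mul_comm]))
    have h3 := Nat.mul_le_mul_right d h2
    have h4 := Nat.mod_lt q ha
    rw [add_mul] at h3
    have h5 : s ≤ t + τ := by
      simp only [blockPlace] at hs
      omega
    exact ⟨s, hs, by_contra fun hsE => hxs (hrec s h5 fun h => hsE ⟨h, by omega, h5⟩)⟩
  have hJ0 : symbol c J = 0 := by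
    rcases hE t with hcard | ⟨c0, hc0⟩
    · refine sparse_first ha hℓ hℓm hZ hC hc (by omega) h0
        {q ∈ Ico (J : ℕ) ((m + (J : ℕ) / a + 1) * a) | symbol c q ≠ 0} (le_trans ?_ hcard) ?_
      · rw [← Set.ncard_coe_finset]
        choose! f hf using hwin
        refine Set.ncard_le_ncard_of_injOn f ?_ ?_ ((Set.finite_Icc _ _).inter_of_right _)
        · intro q hq
          obtain ⟨hq1, hq2⟩ := mem_filter.mp hq
          rw [mem_Ico] at hq1
          exact (hf q hq1.1 hq1.2 hq2).2
        · intro q hq q' hq' hqq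
          obtain ⟨hq1, hq2⟩ := mem_filter.mp hq
          obtain ⟨hq1', hq2'⟩ := mem_filter.mp hq'
          rw [mem_Ico] at hq1 hq1'
          have e1 := (hf q hq1.1 hq1.2 hq2).1
          have e2 := (hf q' hq1'.1 hq1'.2 hq2').1
          rw [hqq, e2] at e1
          exact hmono.injective (by omega)
      · intro q hq hq' h
        exact mem_filter.mpr ⟨mem_Ico.mpr ⟨hq, hq'⟩, h⟩
    · refine burst_first ha hℓ hℓm hZ hC hc (by omega) h0 fun q hq hq' => ?_
      by_contra h
      obtain ⟨s, hs, hsE⟩ := hwin q (by omega) hq' h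
      have h1 := hc0 hsE
      have h2 := hc0 (⟨htE, by simp⟩ : t ∈ E ∩ Set.Icc t (t + τ))
      have h3 := hmono.monotone hq
      -- Advancing `ℓ` blocks takes `ℓ d = b` time steps, out of reach of a burst containing `t`.
      have h4 : blockPlace a d (J + ℓ * a) = blockPlace a d J + ℓ * d := by
        simp only [blockPlace]
        rw [Nat.add_mul_div_right _ _ ha, Nat.add_mul_mod_self_right]
        ring
      rw [Set.mem_Ico] at h1 h2
      omega
  rw [symbol_of_lt c J.2] at hJ0
  simpa only [hcdef, Fin.eta, sub_add_cancel, extendZero_natCast] using hJ0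

/-! ### The upper bound on the rate -/

/-- Periodic bursts of `b` erasures, separated by `τ + 1 - a` unerased packets, are admissible. -/
theorem isAdmissible_periodic {a b τ : ℕ} (hab : a ≤ b) (hbτ : b ≤ τ) :
    IsAdmissible a b τ {t | t % (τ + 1 - a + b) < b} := by
  intro s
  set P := τ + 1 - a + b with hP
  have hr := Nat.mod_lt s (show 0 < P by omega)
  have hs := Nat.div_add_mod s P
  set r := s % P
  set B := P * (s / P)
  have hmem : ∀ t ∈ ({t | t % P < b} ∩ Set.Icc s (s + τ) : Set ℕ),
      s ≤ t ∧ t ≤ s + τ ∧ (t < B + b ∨ B + P ≤ t ∧ t < B + P + b) := by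
    rintro t ⟨ht, h1, h2⟩
    refine ⟨h1, h2, ?_⟩
    obtain ⟨y, rfl⟩ := Nat.exists_eq_add_of_le (show B ≤ t by omega)
    have ht' : (B + y) % P < b := ht
    rw [Nat.mul_add_mod] at ht'
    rcases lt_or_ge y P with h | h
    · rw [Nat.mod_eq_of_lt h] at ht'
      omega
    · rw [Nat.mod_eq_sub_mod h, Nat.mod_eq_of_lt (by omega)] at ht'
      omega
  by_cases hrb : b ≤ r
  · refine Or.inr ⟨B + P, fun t ht => ?_⟩
    have := hmem t ht
    rw [Set.mem_Ico]
    omega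
  by_cases hrP : r + τ < P
  · refine Or.inr ⟨B, fun t ht => ?_⟩
    have := hmem t ht
    rw [Set.mem_Ico]
    omega
  -- The window meets two bursts, so it contains the whole gap between them, leaving `τ + 1 - (τ + 1
  -- - a) = a` places for erasures.
  · left
    have hsub : ({t | t % P < b} ∩ Set.Icc s (s + τ) : Set ℕ) ⊆
        ((Ico s (B + b) ∪ Ico (B + P) (s + τ + 1) : Finset ℕ) : Set ℕ) := by
      intro t ht
      have := hmem t ht
      rw [mem_coe, mem_union, mem_Ico, mem_Ico]
      omega
    refine (Set.ncard_le_ncard hsub (finite_toSet _)).trans ?_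
    rw [Set.ncard_coe_finset]
    refine (card_union_le _ _).trans ?_
    rw [Nat.card_Ico, Nat.card_Ico]
    omega

theorem card_filter_le_mod (P b L : ℕ) :
    #{t ∈ range (L * P) | ¬ t % P < b} ≤ L * (P - b) := by
  induction L with
  | zero => simp
  | succ L ih =>
    have hsub : {t ∈ range ((L + 1) * P) | ¬ t % P < b} ⊆
        {t ∈ range (L * P) | ¬ t % P < b} ∪ Ico (L * P + b) (L * P + P) := by
      intro t ht
      obtain ⟨h1, h2⟩ := mem_filter.mp ht
      rw [mem_range, add_mul, one_mul] at h1
      rw [mem_union, mem_filter, mem_range, mem_Ico]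
      by_cases h : t < L * P
      · exact Or.inl ⟨h, h2⟩
      · obtain ⟨y, rfl⟩ := Nat.exists_eq_add_of_le (not_lt.mp h)
        rw [mul_comm L P, Nat.mul_add_mod, Nat.mod_eq_of_lt (by omega)] at h2
        omega
    refine (card_le_card hsub).trans ((card_union_le _ _).trans ?_)
    rw [Nat.card_Ico, add_mul, one_mul]
    omega

/-- The first `L` periods of messages are determined by the unerased packets up to `τ` steps later,
so there are at most as many message choices as values of these packets. -/
theorem IsStreamingCode.mul_le_mul {A : Type*} [Finite A] [Nontrivial A] {a b τ k n : ℕ}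
    (hab : a ≤ b) (hbτ : b ≤ τ) {X : Set (ℕ → Fin n → A)} (hX : IsStreamingCode a b τ k X) :
    k * (τ + 1 - a + b) ≤ n * (τ + 1 - a) := by
  classical
  have := Fintype.ofFinite A
  obtain ⟨enc, -, -, hdec⟩ := hX
  obtain ⟨z⟩ : Nonempty A := inferInstance
  set P := τ + 1 - a + b with hP
  have hbound : ∀ L, k * (L * P) ≤ n * (L * (τ + 1 - a) + τ) := by
    intro L
    let good : Finset ℕ := {t ∈ range (L * P + τ) | ¬ t % P < b}
    have hgood : #good ≤ L * (τ + 1 - a) + τ := by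
      have h1 : good ⊆ {t ∈ range (L * P) | ¬ t % P < b} ∪ Ico (L * P) (L * P + τ) := by
        intro t ht
        obtain ⟨h1, h2⟩ := mem_filter.mp ht
        rw [mem_range] at h1
        rw [mem_union, mem_filter, mem_range, mem_Ico]
        omega
      have h2 := card_filter_le_mod P b L
      rw [show P - b = τ + 1 - a by omega] at h2
      refine (card_le_card h1).trans ((card_union_le _ _).trans ?_)
      rw [Nat.card_Ico]
      omega
    let u (v : Fin (L * P) → Fin k → A) (t : ℕ) : Fin k → A :=
      if h : t < L * P then v ⟨t, h⟩ else fun _ => z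
    have hinj : Function.Injective fun (v : Fin (L * P) → Fin k → A) (s : good) => enc (u v) s := by
      intro v v' h
      funext t
      have := hdec _ (isAdmissible_periodic hab hbτ) t (u v) (u v') fun s hs hsE =>
        congrFun h ⟨s, mem_filter.mpr ⟨mem_range.mpr (by omega), hsE⟩⟩
      simpa only [u, t.2, dif_pos, Fin.eta] using this
    have hcard := Fintype.card_le_of_injective _ hinj
    simp only [Fintype.card_fun, Fintype.card_fin, Fintype.card_coe, ← pow_mul] at hcard
    exact ((Nat.pow_le_pow_iff_right Fintype.one_lt_card).mp hcard).trans
      (Nat.mul_le_mul_left n hgood)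
  by_contra hlt
  -- A violation gains at least one symbol per period, so `n τ + 1` periods outweigh the boundary
  -- term `n τ`.
  have h1 := hbound (n * τ + 1)
  have h2 := Nat.mul_le_mul_left (n * τ + 1) (Nat.succ_le_of_lt (not_le.mp hlt))
  have h3 : k * ((n * τ + 1) * P) = (n * τ + 1) * (k * P) := by ring
  have h4 : n * ((n * τ + 1) * (τ + 1 - a) + τ) = (n * τ + 1) * (n * (τ + 1 - a)) + n * τ := by ring
  have h5 := Nat.mul_succ (n * τ + 1) (n * (τ + 1 - a))
  omega

theorem IsStreamingCode.rate_le {A : Type*} [Finite A] [Nontrivial A] {a b τ k n : ℕ}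
    (hab : a ≤ b) (hbτ : b ≤ τ) {X : Set (ℕ → Fin n → A)} (hX : IsStreamingCode a b τ k X) :
    (k : ℚ) / n ≤ optimalRate a b τ := by
  have h := hX.mul_le_mul hab hbτ
  have hsub : ((τ + 1 - a : ℕ) : ℚ) = (τ : ℚ) + 1 - a := by
    rw [Nat.cast_sub (by omega)]
    push_cast
    ring
  have hpos : (0 : ℚ) < ((τ + 1 - a : ℕ) : ℚ) := Nat.cast_pos.mpr (by omega)
  rw [optimalRate, ← hsub]
  rcases Nat.eq_zero_or_pos n with rfl | hn
  · rw [Nat.cast_zero, div_zero]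
    positivity
  · rw [div_le_div_iff₀ (by exact_mod_cast hn) (by positivity), mul_comm ((τ + 1 - a : ℕ) : ℚ)]
    exact_mod_cast h

end StreamingCodes

/-! ### Parameters, optimality and field size -/

theorem theorem2 (a b τ g ℓ m : ℕ) (ha : 1 ≤ a) (hab : a ≤ b) (hbτ : b ≤ τ)
    (hg : Nat.gcd b (τ + 1 - a) = a + g)
    (hℓ : ℓ = b / (a + g)) (hm : m = (τ + 1 - a) / (a + g)) :
    -- the placement set has as many elements as the base code has symbols
    StreamingCodes.IsPlacementSet ((m + 1) * a - a + ℓ * a) ((m + ℓ - 1) * (a + g) + a)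
      (StreamingCodes.placementSet a b τ) ∧
    -- the streaming property, for every choice of the two matrices over every finite field
    (∀ (F : Type*) [Field F] [Finite F]
      (Z : Matrix (Fin a) (Fin (2 * a)) F)
      (C : Matrix (Fin (ℓ * a)) (Fin ((m + 1) * a - ℓ * a)) F),
      StreamingCodes.IsZeroBandMDS Z → StreamingCodes.IsCauchy C →
        StreamingCodes.IsInfoPrefix (StreamingCodes.baseCode a ℓ ((m + 1) * a) Z C)
          ((m + 1) * a - a) ∧
        StreamingCodes.IsStreamingCode a b τ ((m + 1) * a - a)
          (StreamingCodes.SDE (StreamingCodes.baseCode a ℓ ((m + 1) * a) Z C)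
            (StreamingCodes.placementSet a b τ))) ∧
    -- the rate
    (((m + 1) * a - a : ℕ) : ℚ) / (((m + 1) * a - a + ℓ * a : ℕ) : ℚ) =
      StreamingCodes.optimalRate a b τ ∧
    -- which no streaming code with the same parameters exceeds, over any finite field
    (∀ (K : Type*) [Field K] [Finite K] (k n : ℕ) (X : Set (ℕ → Fin n → K)),
      StreamingCodes.IsStreamingCode a b τ k X →
        (k : ℚ) / (n : ℚ) ≤ StreamingCodes.optimalRate a b τ) ∧
    -- the field size: the matrices exist over every field with at least `(m + 1) a` elements
    (∀ (F : Type*) [Field F] [Finite F], (m + 1) * a ≤ Nat.card F →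
      (∃ Z : Matrix (Fin a) (Fin (2 * a)) F, StreamingCodes.IsZeroBandMDS Z) ∧
      (∃ C : Matrix (Fin (ℓ * a)) (Fin ((m + 1) * a - ℓ * a)) F, StreamingCodes.IsCauchy C)) ∧
    (m + 1) * a ≤ τ + 1 ∧
    (∃ q : ℕ, IsPrimePow q ∧ (m + 1) * a ≤ q ∧ q ≤ 2 * (τ + 1)) := by
  have hdb : (a + g) ∣ b := hg ▸ Nat.gcd_dvd_left _ _
  have hdτ : (a + g) ∣ τ + 1 - a := hg ▸ Nat.gcd_dvd_right _ _
  have hb : b = ℓ * (a + g) := by rw [hℓ, Nat.div_mul_cancel hdb]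
  have hτ : τ + 1 - a = m * (a + g) := by rw [hm, Nat.div_mul_cancel hdτ]
  have hℓ1 : 1 ≤ ℓ := Nat.one_le_iff_ne_zero.mpr fun h => by rw [h, zero_mul] at hb; omega
  -- If `m < ℓ`, then `b ≥ (m + 1) (a + g) = τ + 1 - a + (a + g) > τ`.
  have hℓm : ℓ ≤ m := by
    by_contra h
    have := Nat.mul_le_mul_right (a + g) (Nat.succ_le_of_lt (not_le.mp h))
    rw [Nat.succ_mul] at this
    omega
  have hS : StreamingCodes.placementSet a b τ = (Finset.range (m + ℓ)).biUnion fun i =>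
      Finset.Ico (i * (a + g)) (i * (a + g) + a) := by
    rw [StreamingCodes.placementSet, hg, ← hm, ← hℓ]
  have hm1 : (m + 1) * a = m * a + a := by ring
  have hn : (m + 1) * a - a + ℓ * a = (m + ℓ) * a := by rw [add_mul m ℓ]; omega
  have hℓa : ℓ * a ≤ (m + 1) * a := Nat.mul_le_mul_right a (by omega)
  have hma : (m + 1) * a ≤ τ + 1 := by
    have := Nat.mul_le_mul_left m (Nat.le_add_right a g)
    omega
  refine ⟨?_, ?_, ?_, ?_, ?_, hma, ?_⟩
  · rw [hS, hn]
    exact StreamingCodes.isPlacementSet_biUnion ha (by omega) (by omega)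
  · intro F _ _ Z C hZ hC
    rw [hS]
    exact ⟨StreamingCodes.baseCode_isInfoPrefix ha hℓ1 hℓm hZ hC,
      StreamingCodes.isStreamingCode_baseCode ha (by omega) hℓ1 hℓm hb (by omega) hZ hC⟩
  · have hsub : (τ : ℚ) + 1 - a = m * (a + g) := by
      have : ((τ + 1 - a : ℕ) : ℚ) = ((m * (a + g) : ℕ) : ℚ) := congrArg _ hτ
      rw [Nat.cast_sub (by omega)] at this
      exact_mod_cast this
    rw [hn, show (m + 1) * a - a = m * a by omega, StreamingCodes.optimalRate, hsub, hb]
    have h1 : (a : ℚ) ≠ 0 := by positivity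
    have h2 : (a : ℚ) + g ≠ 0 := by positivity
    have h3 : (m : ℚ) + ℓ ≠ 0 := by positivity
    push_cast
    rw [← add_mul, mul_div_mul_right _ _ h1, mul_div_mul_right _ _ h2]
  · intro K _ _ k n X hX
    exact hX.rate_le hab hbτ
  · intro F _ _ hF
    exact ⟨StreamingCodes.exists_isZeroBandMDS
      ((Nat.mul_le_mul_right a (by omega : 2 ≤ m + 1)).trans hF),
      StreamingCodes.exists_isCauchy (by omega)⟩
  -- Bertrand's postulate.
  · obtain ⟨p, hp, hlt, hle⟩ := Nat.exists_prime_lt_and_le_two_mul ((m + 1) * a)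
      (by omega)
    exact ⟨p, hp.isPrimePow, hlt.le, by omega⟩
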